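/- All manifolds, diffeomorphisms and vector fields are smooth ($C^\infty$). The \emph{rank} of a manifold $M$, written $\operatorname{rank}(M)$, is the maximal number of pairwise commuting vector fields on $M$ that are linearly independent at each point of $M$. For a diffeomorphism $f\colon N\to N$ of a finite-dimensional manifold $N$ without boundary, the mapping torus $M(f)$ is the quotient manifold $(\mathbb R\times N)/\mathbb Z$, where $k\in\mathbb Z$ acts by $k\cdot(t,x)=(t+k,f^k(x))$; equivalently, it is $[0,1]\times N$ with $(0,x)$ glued to $(1,f(x))$ for every $x\in N$. \textbf{Lemma 1.} Let $f\colon N\to N$ be a diffeomorphism and let $X_1,\dots,X_k$ be pairwise commuting vector fields on $N$ that are linearly independent at every point. Suppose that $f_*X_i=\sum_{j=1}^k a_{ij}X_j$ for $i=1,\dots,k$, where $(a_{ij})\in GL(k,\mathbb R)$ is a constant matrix. Then $\operatorname{rank}(M(f))\ge k$. -/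

import Mathlib

open scoped Manifold ContDiff Topology

noncomputable section

/-! ### Commuting frames and the rank of a smooth manifold -/

/-- `k` smooth vector fields on `M` which commute pairwise and are linearly independent at every
point of `M`. -/
structure IsCommutingIndependentFamily {E : Type*} [NormedAddCommGroup E] [NormedSpace ℝ E]
    {H : Type*} [TopologicalSpace H] (I : ModelWithCorners ℝ E H)
    {M : Type*} [TopologicalSpace M] [ChartedSpace H M] [IsManifold I ∞ M]
    {k : ℕ} (X : Fin k → (x : M) → TangentSpace I x) : Prop where
  smooth : ∀ i, ContMDiff I I.tangent ∞ (fun x ↦ (⟨x, X i x⟩ : TangentBundle I M))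
  commute : ∀ i j x, VectorField.mlieBracket I (X i) (X j) x = 0
  linearIndependent : ∀ x, LinearIndependent ℝ (fun i ↦ X i x)

/-- Milnor's rank of a smooth manifold: the supremum of the numbers `k` such that there are `k`
commuting smooth vector fields on `M` that are linearly independent at each point. On a non-empty
manifold of finite dimension it is a maximum, bounded by the dimension. -/
def manifoldRank {E : Type*} [NormedAddCommGroup E] [NormedSpace ℝ E]
    {H : Type*} [TopologicalSpace H] (I : ModelWithCorners ℝ E H)
    (M : Type*) [TopologicalSpace M] [ChartedSpace H M] [IsManifold I ∞ M] : ℕ∞ :=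
  ⨆ (k : ℕ) (_ : ∃ X : Fin k → (x : M) → TangentSpace I x,
    IsCommutingIndependentFamily I X), (k : ℕ∞)

/-! ### The mapping torus as a smooth manifold -/

/-- The action of `ℤ` on `ℝ × N` given by `k · (t, x) = (t + k, f ^ k x)`. -/
@[reducible]
def mappingTorusAction {N : Type*} (f : Equiv.Perm N) : AddAction ℤ (ℝ × N) where
  vadd k p := (p.1 + k, (f ^ k) p.2)
  zero_vadd p := by
    change (p.1 + ((0 : ℤ) : ℝ), (f ^ (0 : ℤ)) p.2) = p
    simp
  add_vadd k l p := by
    change (p.1 + ((k + l : ℤ) : ℝ), (f ^ (k + l)) p.2)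
      = (p.1 + (l : ℝ) + (k : ℝ), (f ^ k) ((f ^ l) p.2))
    rw [zpow_add, Equiv.Perm.mul_apply]
    push_cast
    rw [add_assoc, add_comm (l : ℝ)]

section MappingTorus

variable {E : Type*} [NormedAddCommGroup E] [NormedSpace ℝ E]
  {H : Type*} [TopologicalSpace H] {I : ModelWithCorners ℝ E H}
  {N : Type*} [TopologicalSpace N] [ChartedSpace H N]

/-- The mapping torus `M(f) = (ℝ × N) / ℤ` of a diffeomorphism `f`, where `ℤ` acts on `ℝ × N` by
`k · (t, x) = (t + k, f ^ k x)`. -/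
def MappingTorus (f : N ≃ₘ⟮I, I⟯ N) : Type _ :=
  Quotient (@AddAction.orbitRel ℤ (ℝ × N) _ (mappingTorusAction f.toEquiv))

namespace MappingTorus

/-- The projection `ℝ × N → M(f)`. -/
def mk (f : N ≃ₘ⟮I, I⟯ N) (p : ℝ × N) : MappingTorus f := Quotient.mk _ p

/-- The quotient topology. -/
instance (f : N ≃ₘ⟮I, I⟯ N) : TopologicalSpace (MappingTorus f) :=
  inferInstanceAs (TopologicalSpace (Quotient _))

theorem mk_surjective (f : N ≃ₘ⟮I, I⟯ N) : Function.Surjective (mk f) := Quotient.mk_surjective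

theorem mk_eq_mk_iff (f : N ≃ₘ⟮I, I⟯ N) (p q : ℝ × N) :
    mk f p = mk f q ↔ ∃ k : ℤ, (q.1 + k, (f.toEquiv ^ k) q.2) = p := by
  let := mappingTorusAction f.toEquiv
  exact Quotient.eq''.trans AddAction.orbitRel_apply

theorem contMDiff_zpow (f : N ≃ₘ⟮I, I⟯ N) (k : ℤ) :
    ContMDiff I I ∞ (fun x ↦ (f.toEquiv ^ k) x) := by
  have h (g : N ≃ₘ⟮I, I⟯ N) (n : ℕ) : ContMDiff I I ∞ (fun x ↦ (g.toEquiv ^ n) x) := by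
    induction n with
    | zero => exact contMDiff_id
    | succ n ih =>
      have : (fun x ↦ (g.toEquiv ^ (n + 1)) x) = g ∘ fun x ↦ (g.toEquiv ^ n) x := by
        funext x
        rw [pow_succ', Equiv.Perm.mul_apply]
        rfl
      rw [this]
      exact g.contMDiff.comp ih
  obtain ⟨n, rfl | rfl⟩ := k.eq_nat_or_neg
  · simpa only [zpow_natCast] using h f n
  · have : f.toEquiv ^ (-(n : ℤ)) = f.symm.toEquiv ^ n := by
      rw [zpow_neg, zpow_natCast, ← inv_pow]
      rfl
    rw [this]
    exact h f.symm n

theorem contMDiff_translate (f : N ≃ₘ⟮I, I⟯ N) (k : ℤ) :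
    ContMDiff (𝓘(ℝ, ℝ).prod I) (𝓘(ℝ, ℝ).prod I) ∞
      (fun p : ℝ × N ↦ (p.1 + (k : ℝ), (f.toEquiv ^ k) p.2)) :=
  ((contDiff_id.add contDiff_const).contMDiff.comp contMDiff_fst).prodMk
    ((contMDiff_zpow f k).comp contMDiff_snd)

theorem isQuotientCoveringMap_mk (f : N ≃ₘ⟮I, I⟯ N) :
    @IsAddQuotientCoveringMap (ℝ × N) (MappingTorus f) _ _ (mk f) ℤ _
      (mappingTorusAction f.toEquiv) := by
  let := mappingTorusAction f.toEquiv
  refine { isQuotientMap_quotient_mk' with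
    continuous_const_vadd := fun k ↦ (contMDiff_translate f k).continuous
    apply_eq_iff_mem_orbit := mk_eq_mk_iff f _ _
    disjoint := fun p ↦ ⟨Metric.ball p.1 (1 / 2) ×ˢ Set.univ,
      prod_mem_nhds (Metric.ball_mem_nhds _ (by norm_num)) Filter.univ_mem, ?_⟩ }
  rintro k ⟨_, ⟨q, hq, rfl⟩, hq'⟩
  have h1 : |q.1 - p.1| < 1 / 2 := hq.1
  have h2 : |q.1 + (k : ℝ) - p.1| < 1 / 2 := hq'.1
  rw [abs_lt] at h1 h2
  have h3 : (-1 : ℝ) < k := by linarith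
  have h4 : (k : ℝ) < 1 := by linarith
  have h5 : (-1 : ℤ) < k := by exact_mod_cast h3
  have h6 : k < (1 : ℤ) := by exact_mod_cast h4
  omega

theorem isLocalHomeomorph_mk (f : N ≃ₘ⟮I, I⟯ N) : IsLocalHomeomorph (mk f) := by
  let := mappingTorusAction f.toEquiv
  exact (isQuotientCoveringMap_mk f).isCoveringMap.isLocalHomeomorph

/-- The charts of `M(f)` are the charts of `ℝ × N` composed with local inverses of the
projection `ℝ × N → M(f)`. -/
instance (f : N ≃ₘ⟮I, I⟯ N) : ChartedSpace (ModelProd ℝ H) (MappingTorus f) :=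
  (isLocalHomeomorph_mk f).chartedSpace (mk_surjective f)

/-- Two local inverses of the projection differ by a smooth map of `ℝ × N`. -/
theorem contMDiffOn_localInverse_trans (f : N ≃ₘ⟮I, I⟯ N) (a b : ℝ × N) :
    ContMDiffOn (𝓘(ℝ, ℝ).prod I) (𝓘(ℝ, ℝ).prod I) ∞
      (((isLocalHomeomorph_mk f).localInverseAt a).symm.trans
        ((isLocalHomeomorph_mk f).localInverseAt b))
      (((isLocalHomeomorph_mk f).localInverseAt a).symm.trans
        ((isLocalHomeomorph_mk f).localInverseAt b)).source := by
  set hf := isLocalHomeomorph_mk f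
  set g := (hf.localInverseAt a).symm.trans (hf.localInverseAt b) with hg
  have key (p : ℝ × N) (hp : p ∈ g.source) : mk f (g p) = mk f p := by
    have hp2 : mk f p ∈ (hf.localInverseAt b).source := by
      simpa [hg] using hp.2
    simpa [hg] using hf.apply_localInverseAt_of_mem hp2
  intro p hp
  obtain ⟨k, hk⟩ := (mk_eq_mk_iff f _ _).1 (key p hp)
  -- near `p` the first coordinate forces the same integer `k`
  have hcont : ContinuousAt (fun q : ℝ × N ↦ (g q).1 - q.1) p :=
    (continuous_fst.continuousAt.comp (g.continuousAt hp)).sub continuous_fst.continuousAt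
  have hval : (g p).1 - p.1 = k := by rw [← hk]; simp
  have hev : ∀ᶠ q in 𝓝 p, |((g q).1 - q.1) - k| < 1 := by
    have := hcont.eventually (Metric.ball_mem_nhds _ one_pos)
    simpa only [hval, Metric.mem_ball, Real.dist_eq] using this
  refine ((contMDiff_translate f k).contMDiffAt.congr_of_eventuallyEq ?_).contMDiffWithinAt
  filter_upwards [hev, g.open_source.mem_nhds hp] with q hq hq'
  obtain ⟨l, hl⟩ := (mk_eq_mk_iff f _ _).1 (key q hq')
  have hlk : l = k := by
    rw [← hl, add_sub_cancel_left] at hq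
    have : |l - k| < 1 := by exact_mod_cast hq
    have := Int.abs_lt_one_iff.1 this
    omega
  rw [← hl, hlk]

/-- `M(f)` is a smooth manifold. -/
instance [IsManifold I ∞ N] (f : N ≃ₘ⟮I, I⟯ N) :
    IsManifold (𝓘(ℝ, ℝ).prod I) ∞ (MappingTorus f) := by
  apply isManifold_of_contDiffOn
  rintro _ _ ⟨q, rfl⟩ ⟨r, rfl⟩
  rw [← contMDiffOn_iff_contDiffOn]
  set J : ModelWithCorners ℝ (ℝ × E) (ModelProd ℝ H) := 𝓘(ℝ, ℝ).prod I
  set hf := isLocalHomeomorph_mk f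
  generalize (mk_surjective f).hasRightInverse.choose q = a
  generalize (mk_surjective f).hasRightInverse.choose r = b
  set u := hf.localInverseAt a
  set v := hf.localInverseAt b
  have hg : ContMDiffOn J J ∞ (u.symm.trans v) (u.symm.trans v).source :=
    contMDiffOn_localInverse_trans f a b
  have hc : ContMDiffOn J J ∞ (chartAt (ModelProd ℝ H) a).symm (chartAt (ModelProd ℝ H) a).target :=
    contMDiffOn_chart_symm
  have hd : ContMDiffOn J J ∞ (chartAt (ModelProd ℝ H) b) (chartAt (ModelProd ℝ H) b).source :=
    contMDiffOn_chart
  apply J.contMDiff.comp_contMDiffOn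
  refine hd.comp (hg.comp (hc.comp (J.contMDiffOn_symm.mono Set.inter_subset_right) ?_) ?_) ?_
  all_goals
    rintro y ⟨hy, -⟩
    simp only [OpenPartialHomeomorph.trans_source, OpenPartialHomeomorph.symm_source,
      OpenPartialHomeomorph.trans_symm_eq_symm_trans_symm,
      OpenPartialHomeomorph.coe_trans, Set.mem_preimage, Set.mem_inter_iff,
      Function.comp_apply, OpenPartialHomeomorph.symm_symm] at hy ⊢
    tauto

end MappingTorus

end MappingTorus

end

noncomputable section

/-! ### Frames on the line that generate commuting vector fields -/

section CommutingFrame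

open Matrix

variable {ι : Type*} [Fintype ι]

/-- At the time `t`, the fields `g i ∂ₜ + ∑ l, B i l X l` built from commuting independent
fields `X l` that do not depend on the time are independent and commute. -/
structure IsCommutingFrameAt (B : ℝ → Matrix ι ι ℝ) (g : ℝ → ι → ℝ) (t : ℝ) : Prop where
  independent : ∀ c : ι → ℝ, c ᵥ* B t = 0 → c ⬝ᵥ g t = 0 → c = 0
  exists_hasDerivAt : ∃ B' : Matrix ι ι ℝ, (∀ i l, HasDerivAt (fun s ↦ B s i l) (B' i l) t) ∧
    ∀ i j l, g t i * B' j l = g t j * B' i l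
  exists_hasDerivAt' : ∃ g' : ι → ℝ, (∀ i, HasDerivAt (fun s ↦ g s i) (g' i) t) ∧
    ∀ i j, g t i * g' j = g t j * g' i

theorem Matrix.mulVec_mul_mulVec_comm {A : Matrix ι ι ℝ} {u v : ι → ℝ}
    (h : ∀ i j, u i * v j = u j * v i) (i j : ι) :
    (A *ᵥ u) i * (A *ᵥ v) j = (A *ᵥ u) j * (A *ᵥ v) i := by
  simp only [mulVec, dotProduct, Finset.sum_mul_sum]
  rw [Finset.sum_comm]
  refine Finset.sum_congr rfl fun m _ ↦ Finset.sum_congr rfl fun n _ ↦ ?_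
  linear_combination A i n * A j m * h n m

namespace IsCommutingFrameAt

variable {B C : ℝ → Matrix ι ι ℝ} {g h : ℝ → ι → ℝ} {t : ℝ}

theorem congr_of_eventuallyEq (hB : IsCommutingFrameAt B g t) (hC : C =ᶠ[𝓝 t] B)
    (hh : h =ᶠ[𝓝 t] g) : IsCommutingFrameAt C h t := by
  obtain ⟨h1, ⟨B', h2, h3⟩, g', h4, h5⟩ := hB
  refine ⟨by rwa [hC.eq_of_nhds, hh.eq_of_nhds], ⟨B', fun i l ↦ ?_, by rwa [hh.eq_of_nhds]⟩,
    g', fun i ↦ ?_, by rwa [hh.eq_of_nhds]⟩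
  · exact (h2 i l).congr_of_eventuallyEq (hC.fun_comp fun M ↦ M i l)
  · exact (h4 i).congr_of_eventuallyEq (hh.fun_comp fun v ↦ v i)

theorem comp {φ : ℝ → ℝ} {φ' : ℝ} (hB : IsCommutingFrameAt B g (φ t)) (hφ : HasDerivAt φ φ' t) :
    IsCommutingFrameAt (fun s ↦ B (φ s)) (fun s ↦ g (φ s)) t := by
  obtain ⟨h1, ⟨B', h2, h3⟩, g', h4, h5⟩ := hB
  refine ⟨h1, ⟨φ' • B', fun i l ↦ ?_, fun i j l ↦ ?_⟩, φ' • g', fun i ↦ ?_, fun i j ↦ ?_⟩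
  · simpa [mul_comm, Function.comp_def] using (h2 i l).comp t hφ
  · simp only [Matrix.smul_apply, smul_eq_mul]
    linear_combination φ' * h3 i j l
  · simpa [mul_comm, Function.comp_def] using (h4 i).comp t hφ
  · simp only [Pi.smul_apply, smul_eq_mul]
    linear_combination φ' * h5 i j

theorem const_mul [DecidableEq ι] {A : Matrix ι ι ℝ} (hA : A.det ≠ 0)
    (hB : IsCommutingFrameAt B g t) :
    IsCommutingFrameAt (fun s ↦ A * B s) (fun s ↦ A *ᵥ g s) t := by
  obtain ⟨h1, ⟨B', h2, h3⟩, g', h4, h5⟩ := hB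
  refine ⟨fun c hc hc' ↦ ?_, ⟨A * B', fun i l ↦ ?_, fun i j l ↦ ?_⟩, A *ᵥ g', fun i ↦ ?_,
    fun i j ↦ ?_⟩
  · rw [← vecMul_vecMul] at hc
    rw [dotProduct_mulVec] at hc'
    exact eq_zero_of_vecMul_eq_zero hA (h1 _ hc hc')
  · simp only [mul_apply]
    exact HasDerivAt.fun_sum fun m _ ↦ (h2 m l).const_mul _
  · exact mulVec_mul_mulVec_comm (v := fun m ↦ B' m l) (fun i j ↦ h3 i j l) i j
  · simp only [mulVec, dotProduct]
    exact HasDerivAt.fun_sum fun m _ ↦ (h4 m).const_mul _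
  · exact mulVec_mul_mulVec_comm h5 i j

theorem mul_const [DecidableEq ι] {A : Matrix ι ι ℝ} (hA : A.det ≠ 0)
    (hB : IsCommutingFrameAt B g t) : IsCommutingFrameAt (fun s ↦ B s * A) g t := by
  obtain ⟨h1, ⟨B', h2, h3⟩, h4⟩ := hB
  refine ⟨fun c hc hc' ↦ ?_, ⟨B' * A, fun i l ↦ ?_, fun i j l ↦ ?_⟩, h4⟩
  · rw [← vecMul_vecMul] at hc
    exact h1 _ (eq_zero_of_vecMul_eq_zero hA hc) hc'
  · simp only [mul_apply]
    exact HasDerivAt.fun_sum fun m _ ↦ (h2 i m).mul_const _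
  · simp only [mul_apply, Finset.mul_sum]
    refine Finset.sum_congr rfl fun m _ ↦ ?_
    linear_combination A m l * h3 i j m

theorem of_eq_zero [DecidableEq ι] (hB : ∀ i l, DifferentiableAt ℝ (fun s ↦ B s i l) t)
    (hg : ∀ i, DifferentiableAt ℝ (fun s ↦ g s i) t) (hdet : (B t).det ≠ 0) (h0 : g t = 0) :
    IsCommutingFrameAt B g t := by
  refine ⟨fun c hc _ ↦ eq_zero_of_vecMul_eq_zero hdet hc,
    ⟨Matrix.of fun i l ↦ deriv (fun s ↦ B s i l) t, fun i l ↦ (hB i l).hasDerivAt, ?_⟩,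
    fun i ↦ deriv (fun s ↦ g s i) t, fun i ↦ (hg i).hasDerivAt, ?_⟩ <;> simp [h0]

end IsCommutingFrameAt

variable [DecidableEq ι]

/-- A smooth path of commuting frames from the standard frame to the frame given by the rows
of `A`. -/
structure IsCommutingFramePath (B : ℝ → Matrix ι ι ℝ) (g : ℝ → ι → ℝ) (A : Matrix ι ι ℝ) :
    Prop where
  contDiff : ∀ i l, ContDiff ℝ ∞ (fun t ↦ B t i l)
  contDiff' : ∀ i, ContDiff ℝ ∞ (fun t ↦ g t i)
  frame : ∀ t, IsCommutingFrameAt B g t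
  eq_one : ∀ t ≤ 0, B t = 1
  eq_zero_of_nonpos : ∀ t ≤ 0, g t = 0
  eq_end : ∀ t, 1 ≤ t → B t = A
  eq_zero_of_one_le : ∀ t, 1 ≤ t → g t = 0

/-- `A` can be joined to the identity by a smooth path of commuting frames. -/
def IsCommutingFrameReachable (A : Matrix ι ι ℝ) : Prop :=
  ∃ B g, IsCommutingFramePath B g A

namespace IsCommutingFrameReachable

variable {A₁ A₂ : Matrix ι ι ℝ}

theorem one : IsCommutingFrameReachable (1 : Matrix ι ι ℝ) :=
  ⟨fun _ ↦ 1, fun _ ↦ 0, fun _ _ ↦ contDiff_const, fun _ ↦ contDiff_const,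
    fun _ ↦ .of_eq_zero (fun _ _ ↦ differentiableAt_const _) (fun _ ↦ differentiableAt_const _)
      (by simp) rfl, fun _ _ ↦ rfl, fun _ _ ↦ rfl, fun _ _ ↦ rfl, fun _ _ ↦ rfl⟩

theorem mul (hA₁ : A₁.det ≠ 0) (h₁ : IsCommutingFrameReachable A₁)
    (h₂ : IsCommutingFrameReachable A₂) : IsCommutingFrameReachable (A₁ * A₂) := by
  obtain ⟨B₁, g₁, h₁⟩ := h₁
  obtain ⟨B₂, g₂, h₂⟩ := h₂
  let B : ℝ → Matrix ι ι ℝ := fun t ↦ B₁ (2 * t) + A₁ * (B₂ (2 * t - 1) - 1)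
  let g : ℝ → ι → ℝ := fun t ↦ g₁ (2 * t) + A₁ *ᵥ g₂ (2 * t - 1)
  have hBl (t : ℝ) (ht : t ≤ 1 / 2) : B t = B₁ (2 * t) := by
    simp [B, h₂.eq_one (2 * t - 1) (by linarith)]
  have hgl (t : ℝ) (ht : t ≤ 1 / 2) : g t = g₁ (2 * t) := by
    simp [g, h₂.eq_zero_of_nonpos (2 * t - 1) (by linarith)]
  have hBr (t : ℝ) (ht : 1 / 2 ≤ t) : B t = A₁ * B₂ (2 * t - 1) := by
    simp [B, h₁.eq_end (2 * t) (by linarith), mul_sub]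
  have hgr (t : ℝ) (ht : 1 / 2 ≤ t) : g t = A₁ *ᵥ g₂ (2 * t - 1) := by
    simp [g, h₁.eq_zero_of_one_le (2 * t) (by linarith)]
  have hB (i l : ι) : ContDiff ℝ ∞ (fun t ↦ B t i l) := by
    have h1 := (h₁.contDiff i l).comp (contDiff_const.mul contDiff_id : ContDiff ℝ ∞ (fun t : ℝ ↦ 2 * t))
    have h2 (m : ι) := (h₂.contDiff m l).comp
      ((contDiff_const.mul contDiff_id).sub contDiff_const : ContDiff ℝ ∞ (fun t : ℝ ↦ 2 * t - 1))
    simp only [B, Matrix.add_apply, mul_apply, Matrix.sub_apply]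
    exact h1.add (ContDiff.sum fun m _ ↦ contDiff_const.mul ((h2 m).sub contDiff_const))
  have hg (i : ι) : ContDiff ℝ ∞ (fun t ↦ g t i) := by
    have h1 := (h₁.contDiff' i).comp (contDiff_const.mul contDiff_id : ContDiff ℝ ∞ (fun t : ℝ ↦ 2 * t))
    have h2 (m : ι) := (h₂.contDiff' m).comp
      ((contDiff_const.mul contDiff_id).sub contDiff_const : ContDiff ℝ ∞ (fun t : ℝ ↦ 2 * t - 1))
    simp only [g, Pi.add_apply, mulVec, dotProduct]
    exact h1.add (ContDiff.sum fun m _ ↦ contDiff_const.mul (h2 m))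
  refine ⟨B, g, hB, hg, fun t ↦ ?_, fun t ht ↦ ?_, fun t ht ↦ ?_, fun t ht ↦ ?_, fun t ht ↦ ?_⟩
  · rcases lt_trichotomy t (1 / 2) with ht | rfl | ht
    · refine ((h₁.frame (2 * t)).comp (φ := (2 * ·)) (hasDerivAt_const_mul 2)).congr_of_eventuallyEq
        ?_ ?_ <;> filter_upwards [Iio_mem_nhds ht] with s hs
      exacts [hBl s hs.le, hgl s hs.le]
    · refine .of_eq_zero (fun i l ↦ (hB i l).differentiable (by simp) _)
        (fun i ↦ (hg i).differentiable (by simp) _) ?_ ?_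
      · rwa [hBl _ le_rfl, h₁.eq_end _ (by norm_num)]
      · rw [hgl _ le_rfl, h₁.eq_zero_of_one_le _ (by norm_num)]
    · refine (((h₂.frame (2 * t - 1)).comp (φ := (2 * · - 1))
        ((hasDerivAt_const_mul 2).sub_const 1)).const_mul hA₁).congr_of_eventuallyEq
        ?_ ?_ <;> filter_upwards [Ioi_mem_nhds ht] with s hs
      exacts [hBr s hs.le, hgr s hs.le]
  · rw [hBl t (by linarith), h₁.eq_one _ (by linarith)]
  · rw [hgl t (by linarith), h₁.eq_zero_of_nonpos _ (by linarith)]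
  · rw [hBr t (by linarith), h₂.eq_end _ (by linarith)]
  · rw [hgr t (by linarith), h₂.eq_zero_of_one_le _ (by linarith), mulVec_zero]

theorem transvection (T : TransvectionStruct ι ℝ) : IsCommutingFrameReachable T.toMatrix := by
  let s := Real.smoothTransition
  have hB (i l : ι) : ContDiff ℝ ∞ (fun t ↦ Matrix.transvection T.i T.j (s t * T.c) i l) := by
    simp only [Matrix.transvection, Matrix.add_apply, Matrix.single_apply]
    refine contDiff_const.add ?_
    split_ifs
    exacts [Real.smoothTransition.contDiff.mul contDiff_const, contDiff_const]
  refine ⟨fun t ↦ Matrix.transvection T.i T.j (s t * T.c), fun _ ↦ 0, hB, fun _ ↦ contDiff_const,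
    fun t ↦ .of_eq_zero (fun i l ↦ (hB i l).differentiable (by simp) _)
      (fun _ ↦ differentiableAt_const _) (by simp [det_transvection_of_ne _ _ T.hij]) rfl,
    fun t ht ↦ ?_, fun _ _ ↦ rfl, fun t ht ↦ ?_, fun _ _ ↦ rfl⟩
  · simp [s, Real.smoothTransition.zero_of_nonpos ht]
  · simp [s, Real.smoothTransition.one_of_one_le ht, TransvectionStruct.toMatrix]

/-- While one diagonal entry moves from `1` to `d`, possibly through `0`, the corresponding field
has a component along `∂ₜ`. -/
theorem diagonal_update (i : ι) {d : ℝ} (hd : d ≠ 0) :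
    IsCommutingFrameReachable (diagonal (Function.update 1 i d)) := by
  let s := Real.smoothTransition
  have hs : ContDiff ℝ ∞ s := Real.smoothTransition.contDiff
  let b : ℝ → ℝ := fun t ↦ 1 + s t * (d - 1)
  let e : ℝ → ℝ := fun t ↦ s t * (1 - s t)
  have hb : ContDiff ℝ ∞ b := contDiff_const.add (hs.mul contDiff_const)
  have he : ContDiff ℝ ∞ e := hs.mul (contDiff_const.sub hs)
  have hBe (p l : ι) (h : p ≠ i) (t : ℝ) :
      diagonal (Function.update 1 i (b t)) p l = diagonal (1 : ι → ℝ) p l := by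
    by_cases hpl : p = l
    · subst hpl
      simp [h]
    · simp [hpl]
  have hB (p l : ι) : ContDiff ℝ ∞ (fun t ↦ diagonal (Function.update 1 i (b t)) p l) := by
    by_cases h : p = i
    · subst h
      by_cases hl : p = l
      · subst hl
        simpa using hb
      · simpa [hl] using contDiff_const
    · simpa only [hBe p l h] using contDiff_const
  have hg (p : ι) : ContDiff ℝ ∞ (fun t ↦ (Pi.single i (e t) : ι → ℝ) p) := by
    by_cases h : p = i
    · subst h
      simpa using he
    · simpa [h] using contDiff_const
  refine ⟨fun t ↦ diagonal (Function.update 1 i (b t)), fun t ↦ Pi.single i (e t), hB, hg,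
    fun t ↦ ⟨fun c hc hc' ↦ ?_, ⟨Matrix.of fun p l ↦ deriv (fun t ↦ diagonal
      (Function.update 1 i (b t)) p l) t, fun p l ↦
        ((hB p l).differentiable (by simp) t).hasDerivAt, fun p q l ↦ ?_⟩,
      fun p ↦ deriv (fun t ↦ (Pi.single i (e t) : ι → ℝ) p) t, fun p ↦
        ((hg p).differentiable (by simp) t).hasDerivAt, fun p q ↦ ?_⟩,
    fun t ht ↦ ?_, fun t ht ↦ ?_, fun t ht ↦ ?_, fun t ht ↦ ?_⟩
  · have hc1 (j : ι) := congrFun hc j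
    simp only [vecMul_diagonal, Pi.zero_apply] at hc1
    funext j
    by_cases h : j = i
    · subst h
      have h1 := hc1 j
      simp only [Function.update_self] at h1
      simp only [dotProduct_single] at hc'
      by_contra hne
      have h2 : b t = 0 := (mul_eq_zero.1 h1).resolve_left hne
      rcases mul_eq_zero.1 ((mul_eq_zero.1 hc').resolve_left hne) with h3 | h3
      · simp [b, h3] at h2
      · have : s t = 1 := by linarith
        simp [b, this, hd] at h2
    · simpa [h] using hc1 j
  · rcases eq_or_ne p q with rfl | hpq
    · rfl
    by_cases hp : p = i
    · have hq : q ≠ i := hp ▸ hpq.symm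
      simp [hq, hBe q l hq]
    · simp [hp, hBe p l hp]
  · rcases eq_or_ne p q with rfl | hpq
    · rfl
    by_cases hp : p = i
    · have hq : q ≠ i := hp ▸ hpq.symm
      simp [hq]
    · simp [hp]
  · simp [b, s, Real.smoothTransition.zero_of_nonpos ht]
  · simp [e, s, Real.smoothTransition.zero_of_nonpos ht]
  · simp [b, s, Real.smoothTransition.one_of_one_le ht]
  · simp [e, s, Real.smoothTransition.one_of_one_le ht]

theorem diagonal (D : ι → ℝ) (hD : (Matrix.diagonal D).det ≠ 0) :
    IsCommutingFrameReachable (Matrix.diagonal D) := by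
  have hD' (i : ι) : D i ≠ 0 := fun h ↦ hD <| by
    rw [det_diagonal]
    exact Finset.prod_eq_zero (Finset.mem_univ i) h
  have key (S : Finset ι) :
      IsCommutingFrameReachable (Matrix.diagonal fun i ↦ if i ∈ S then D i else 1) := by
    induction S using Finset.induction_on with
    | empty => simpa using one
    | insert a S ha ih =>
      have : (Matrix.diagonal fun i ↦ if i ∈ insert a S then D i else 1) =
          Matrix.diagonal (Function.update 1 a (D a)) *
            Matrix.diagonal fun i ↦ if i ∈ S then D i else 1 := by
        rw [diagonal_mul_diagonal]
        congr 1
        funext i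
        rcases eq_or_ne i a with rfl | h
        · simp [ha]
        · simp [h]
      rw [this]
      refine mul ?_ (diagonal_update a (hD' a)) ih
      rw [det_diagonal]
      refine Finset.prod_ne_zero_iff.2 fun i _ ↦ ?_
      rcases eq_or_ne i a with rfl | h
      · simpa using hD' i
      · simp [h]
  simpa using key Finset.univ

theorem of_det_ne_zero (A : Matrix ι ι ℝ) (hA : A.det ≠ 0) : IsCommutingFrameReachable A :=
  diagonal_transvection_induction_of_det_ne_zero _ A hA diagonal transvection
    fun _ _ h _ h₁ h₂ ↦ mul h h₁ h₂

end IsCommutingFrameReachable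

/-- Every invertible matrix is the monodromy of a smooth quasi-periodic commuting frame. -/
theorem exists_quasiperiodic_commutingFrame (A : GeneralLinearGroup ι ℝ) :
    ∃ (B : ℝ → Matrix ι ι ℝ) (g : ℝ → ι → ℝ), (∀ i l, ContDiff ℝ ∞ (fun t ↦ B t i l)) ∧
      (∀ i, ContDiff ℝ ∞ (fun t ↦ g t i)) ∧ (∀ t, IsCommutingFrameAt B g t) ∧
      (∀ t, B (t + 1) = B t * A) ∧ ∀ t, g (t + 1) = g t := by
  have hdet (C : GeneralLinearGroup ι ℝ) : (C : Matrix ι ι ℝ).det ≠ 0 := C.det.ne_zero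
  obtain ⟨B, g, h⟩ := IsCommutingFrameReachable.of_det_ne_zero (A : Matrix ι ι ℝ) (hdet A)
  let C : ℝ → Matrix ι ι ℝ := fun t ↦ B (Int.fract t) * (A ^ ⌊t⌋ : GeneralLinearGroup ι ℝ)
  let e : ℝ → ι → ℝ := fun t ↦ g (Int.fract t)
  have hloc (n : ℤ) (t : ℝ) (ht : t ∈ Set.Ioo ((n : ℝ) - 1) (n + 1)) :
      C t = (B (t - (n - 1)) + (B (t - n) - 1) * (A : Matrix ι ι ℝ)) *
        (A ^ (n - 1) : GeneralLinearGroup ι ℝ) ∧ e t = g (t - (n - 1)) + g (t - n) := by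
    have hA : (A : Matrix ι ι ℝ) * (A ^ (n - 1) : GeneralLinearGroup ι ℝ) =
        (A ^ n : GeneralLinearGroup ι ℝ) := by
      rw [← Units.val_mul, ← _root_.zpow_one_add]
      congr 2
      ring
    rcases lt_or_ge t n with h1 | h1
    · have hf : ⌊t⌋ = n - 1 := by
        rw [Int.floor_eq_iff]
        push_cast
        constructor <;> linarith [ht.1]
      have hr : Int.fract t = t - (n - 1) := by
        rw [Int.fract, hf]
        push_cast
        ring
      simp only [C, e, hr, hf, h.eq_one (t - n) (by linarith),
        h.eq_zero_of_nonpos (t - n) (by linarith), sub_self, zero_mul, add_zero, and_self]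
    · have hf : ⌊t⌋ = n := by
        rw [Int.floor_eq_iff]
        exact ⟨h1, ht.2⟩
      simp only [C, e, Int.fract, hf, h.eq_end (t - (n - 1)) (by linarith),
        h.eq_zero_of_one_le (t - (n - 1)) (by linarith)]
      refine ⟨?_, (zero_add _).symm⟩
      rw [sub_mul, one_mul, add_sub_cancel, mul_assoc, hA]
  have hmem (t : ℝ) : Set.Ioo ((⌊t⌋ : ℝ) - 1) (⌊t⌋ + 1) ∈ 𝓝 t :=
    Ioo_mem_nhds (by linarith [Int.floor_le t]) (Int.lt_floor_add_one t)
  have hC (i l : ι) : ContDiff ℝ ∞ (fun t ↦ C t i l) := by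
    refine contDiff_iff_contDiffAt.2 fun t ↦ ContDiffAt.congr_of_eventuallyEq ?_
      (Filter.eventuallyEq_of_mem (hmem t) fun s hs ↦ congrArg (fun M : Matrix ι ι ℝ ↦ M i l) (hloc ⌊t⌋ s hs).1)
    have h1 (c : ℝ) (p q : ι) : ContDiff ℝ ∞ (fun s ↦ B (s - c) p q) :=
      (h.contDiff p q).comp (contDiff_id.sub contDiff_const)
    simp only [mul_apply, Matrix.add_apply, Matrix.sub_apply]
    exact (ContDiff.sum fun m _ ↦ ((h1 _ _ _).add (ContDiff.sum fun p _ ↦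
      ((h1 _ _ _).sub contDiff_const).mul contDiff_const)).mul contDiff_const).contDiffAt
  have he (i : ι) : ContDiff ℝ ∞ (fun t ↦ e t i) := by
    refine contDiff_iff_contDiffAt.2 fun t ↦ ContDiffAt.congr_of_eventuallyEq ?_
      (Filter.eventuallyEq_of_mem (hmem t) fun s hs ↦ congrArg (fun M : ι → ℝ ↦ M i) (hloc ⌊t⌋ s hs).2)
    have h1 (c : ℝ) : ContDiff ℝ ∞ (fun s ↦ g (s - c) i) :=
      (h.contDiff' i).comp (contDiff_id.sub contDiff_const)
    exact ((h1 _).add (h1 _)).contDiffAt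
  refine ⟨C, e, hC, he, fun t ↦ ?_, fun t ↦ ?_, fun t ↦ ?_⟩
  · rcases (Int.floor_le t).eq_or_lt with ht | ht
    · have hf : Int.fract t = 0 := by rw [Int.fract, ht, sub_self]
      refine .of_eq_zero (fun i l ↦ (hC i l).differentiable (by simp) _)
        (fun i ↦ (he i).differentiable (by simp) _) ?_ ?_
      · simpa only [C, hf, h.eq_one 0 le_rfl, one_mul] using hdet _
      · simp only [e, hf, h.eq_zero_of_nonpos 0 le_rfl]
    · refine (((h.frame (t - ⌊t⌋)).comp (φ := (· - (⌊t⌋ : ℝ)))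
        ((hasDerivAt_id t).sub_const _)).mul_const (hdet (A ^ ⌊t⌋))).congr_of_eventuallyEq
        ?_ ?_ <;> filter_upwards [Ioo_mem_nhds ht (Int.lt_floor_add_one t)] with s hs
      all_goals
        have hf : ⌊s⌋ = ⌊t⌋ := Int.floor_eq_iff.2 ⟨hs.1.le, hs.2⟩
        simp only [C, e, Int.fract, hf]
  · simp only [C, Int.fract_add_one, Int.floor_add_one, _root_.zpow_add_one, Units.val_mul, mul_assoc]
  · simp only [e, Int.fract_add_one]

end CommutingFrame

/-! ### Vector fields on `ℝ × N` built from time-dependent combinations of commuting fields -/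

section ProductField

variable {ι : Type*} [Fintype ι] {E : Type*} [NormedAddCommGroup E] [NormedSpace ℝ E]

open VectorField in
theorem lieBracket_prod_combination_eq_zero {g h : ℝ → ℝ} {b c : ℝ → ι → ℝ} {Z : ι → E → E}
    {t : ℝ} {y : E} {g' h' : ℝ} {b' c' : ι → ℝ} (hZ : ∀ l, DifferentiableAt ℝ (Z l) y)
    (hcomm : ∀ l m, lieBracket ℝ (Z l) (Z m) y = 0) (hg : HasDerivAt g g' t)
    (hh : HasDerivAt h h' t) (hb : ∀ l, HasDerivAt (fun s ↦ b s l) (b' l) t)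
    (hc : ∀ l, HasDerivAt (fun s ↦ c s l) (c' l) t) (hgh : g t * h' = h t * g')
    (hbc : ∀ l, g t * c' l = h t * b' l) :
    lieBracket ℝ (fun p : ℝ × E ↦ (g p.1, ∑ l, b p.1 l • Z l p.2))
      (fun p : ℝ × E ↦ (h p.1, ∑ l, c p.1 l • Z l p.2)) (t, y) = 0 := by
  have hfst : HasFDerivAt (Prod.fst : ℝ × E → ℝ) (ContinuousLinearMap.fst ℝ ℝ E) (t, y) :=
    hasFDerivAt_fst
  have hsnd : HasFDerivAt (Prod.snd : ℝ × E → E) (ContinuousLinearMap.snd ℝ ℝ E) (t, y) :=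
    hasFDerivAt_snd
  have key {g : ℝ → ℝ} {b : ℝ → ι → ℝ} {g' : ℝ} {b' : ι → ℝ} (hg : HasDerivAt g g' t)
      (hb : ∀ l, HasDerivAt (fun s ↦ b s l) (b' l) t) (τ : ℝ) (η : E) :
      fderiv ℝ (fun p : ℝ × E ↦ (g p.1, ∑ l, b p.1 l • Z l p.2)) (t, y) (τ, η) =
        (τ * g', ∑ l, (b t l • fderiv ℝ (Z l) y η + (τ * b' l) • Z l y)) := by
    have h1 := hg.hasFDerivAt.comp (t, y) hfst
    have h2 (l : ι) := ((hb l).hasFDerivAt.comp (t, y) hfst).smul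
      ((hZ l).hasFDerivAt.comp (t, y) hsnd)
    have h3 := h1.prodMk (HasFDerivAt.fun_sum fun l (_ : l ∈ Finset.univ) ↦ h2 l)
    have h4 := congrArg (fun L ↦ L (τ, η)) h3.fderiv
    refine h4.trans ?_
    simp
  have hcomm' (l m : ι) : fderiv ℝ (Z l) y (Z m y) = fderiv ℝ (Z m) y (Z l y) := by
    have := hcomm m l
    rwa [lieBracket, sub_eq_zero] at this
  rw [lieBracket, key hg hb, key hh hc, Prod.mk_sub_mk, Prod.mk_eq_zero, ← Finset.sum_sub_distrib]
  refine ⟨by linear_combination hgh, ?_⟩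
  simp only [map_sum, map_smul, Finset.smul_sum, add_sub_add_comm, hbc, sub_self, add_zero, Finset.sum_sub_distrib]
  rw [sub_eq_zero, Finset.sum_comm]
  refine Finset.sum_congr rfl fun l _ ↦ Finset.sum_congr rfl fun m _ ↦ ?_
  rw [hcomm' m l, smul_comm]

variable {H : Type*} [TopologicalSpace H] (I : ModelWithCorners ℝ E H)
  {N : Type*} [TopologicalSpace N] [ChartedSpace H N]

/-- The vector field `g(t) ∂ₜ + ∑ l, b(t) l X l` on `ℝ × N`. -/
def timeCombination (g : ℝ → ℝ) (b : ℝ → ι → ℝ) (X : ι → (x : N) → TangentSpace I x) (p : ℝ × N) :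
    TangentSpace (𝓘(ℝ, ℝ).prod I) p :=
  ((g p.1, ∑ l, b p.1 l • X l p.2) : ℝ × E)

variable {I} {g : ℝ → ℝ} {b : ℝ → ι → ℝ} {X : ι → (x : N) → TangentSpace I x}

theorem contMDiff_timeCombination [IsManifold I ∞ N] (hg : ContDiff ℝ ∞ g)
    (hb : ∀ l, ContDiff ℝ ∞ (fun t ↦ b t l))
    (hX : ∀ l, ContMDiff I I.tangent ∞ (fun x ↦ (⟨x, X l x⟩ : TangentBundle I N))) :
    ContMDiff (𝓘(ℝ, ℝ).prod I) (𝓘(ℝ, ℝ).prod I).tangent ∞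
      (fun p ↦ (⟨p, timeCombination I g b X p⟩ : TangentBundle (𝓘(ℝ, ℝ).prod I) (ℝ × N))) := by
  have : IsManifold I 1 N := .of_le (n := ∞) (by simp)
  let X₁ (l : ι) (p : ℝ × N) : TangentSpace (𝓘(ℝ, ℝ).prod I) p := ((0, X l p.2) : ℝ × E)
  let T (p : ℝ × N) : TangentSpace (𝓘(ℝ, ℝ).prod I) p := ((g p.1, 0) : ℝ × E)
  have hX₁ (l : ι) : ContMDiff (𝓘(ℝ, ℝ).prod I) (𝓘(ℝ, ℝ).prod I).tangent ∞
      (fun p ↦ (⟨p, X₁ l p⟩ : TangentBundle (𝓘(ℝ, ℝ).prod I) (ℝ × N))) :=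
    contMDiff_equivTangentBundleProd_symm.comp
      ((((Bundle.contMDiff_zeroSection ℝ (TangentSpace 𝓘(ℝ, ℝ) (M := ℝ))).comp
        contMDiff_fst).prodMk ((hX l).comp contMDiff_snd)))
  have hT : ContMDiff (𝓘(ℝ, ℝ).prod I) (𝓘(ℝ, ℝ).prod I).tangent ∞
      (fun p ↦ (⟨p, T p⟩ : TangentBundle (𝓘(ℝ, ℝ).prod I) (ℝ × N))) := by
    have : ContMDiff 𝓘(ℝ, ℝ) 𝓘(ℝ, ℝ).tangent ∞
        (fun t ↦ (⟨t, g t⟩ : TangentBundle 𝓘(ℝ, ℝ) ℝ)) :=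
      contMDiff_vectorSpace_iff_contDiff.2 hg
    exact contMDiff_equivTangentBundleProd_symm.comp
      ((this.comp contMDiff_fst).prodMk
        ((Bundle.contMDiff_zeroSection ℝ (TangentSpace I (M := N))).comp contMDiff_snd))
  have hsum := ContMDiff.sum_section (s := Finset.univ) fun l _ ↦
    ContMDiff.smul_section ((hb l).contMDiff.comp contMDiff_fst) (hX₁ l)
  convert hT.add_section hsum using 2 with p
  refine congrArg (fun v : ℝ × E ↦
    (⟨p, v⟩ : TangentBundle (𝓘(ℝ, ℝ).prod I) (ℝ × N))) (Prod.ext ?_ ?_)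
  · change g p.1 = g p.1 + (∑ l, b p.1 l • ((0, X l p.2) : ℝ × E)).1
    simp [Prod.fst_sum]
  · change ∑ l, b p.1 l • X l p.2 = (0 : E) + (∑ l, b p.1 l • ((0, X l p.2) : ℝ × E)).2
    rw [Prod.snd_sum, zero_add]
    rfl


open VectorField in
/-- The vanishing of the Lie bracket on a boundaryless manifold can be tested in a chart. -/
theorem mlieBracket_eq_zero_iff_lieBracket [I.Boundaryless] [IsManifold I 1 N]
    {V W : (x : N) → TangentSpace I x} {x : N} {V' W' : E → E}
    (hV : ∀ᶠ y in 𝓝 (extChartAt I x x), V ((extChartAt I x).symm y) =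
      mfderivWithin 𝓘(ℝ, E) I (extChartAt I x).symm (Set.range I) y (V' y))
    (hW : ∀ᶠ y in 𝓝 (extChartAt I x x), W ((extChartAt I x).symm y) =
      mfderivWithin 𝓘(ℝ, E) I (extChartAt I x).symm (Set.range I) y (W' y)) :
    mlieBracket I V W x = 0 ↔ lieBracket ℝ V' W' (extChartAt I x x) = 0 := by
  have key (V : (x : N) → TangentSpace I x) (V' : E → E)
      (hV : ∀ᶠ y in 𝓝 (extChartAt I x x), V ((extChartAt I x).symm y) =
        mfderivWithin 𝓘(ℝ, E) I (extChartAt I x).symm (Set.range I) y (V' y)) :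
      (mpullbackWithin 𝓘(ℝ, E) I (extChartAt I x).symm V (Set.range I) : E → E)
        =ᶠ[𝓝 (extChartAt I x x)] V' := by
    filter_upwards [hV, extChartAt_target_mem_nhds (I := I) x] with y hy hy'
    exact (congrArg _ hy).trans
      ((isInvertible_mfderivWithin_extChartAt_symm hy').inverse_apply_self (V' y))
  have hset : (extChartAt I x).symm ⁻¹' Set.univ ∩ Set.range I = Set.univ := by
    rw [Set.preimage_univ, Set.univ_inter, I.range_eq_univ]
  have h1 (V₁ W₁ : E → E) (hV₁ : V₁ =ᶠ[𝓝 (extChartAt I x x)] V')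
      (hW₁ : W₁ =ᶠ[𝓝 (extChartAt I x x)] W') : lieBracketWithin ℝ V₁ W₁
        ((extChartAt I x).symm ⁻¹' Set.univ ∩ Set.range I) (extChartAt I x x) =
          lieBracket ℝ V' W' (extChartAt I x x) := by
    rw [hset, lieBracketWithin_univ, hV₁.lieBracket_vectorField_eq hW₁]
  have hinv := (isInvertible_mfderiv_extChartAt (I := I) (mem_extChartAt_source x)).inverse
  have h3 : mlieBracket I V W x =
      (mfderiv I 𝓘(ℝ, E) (extChartAt I x) x).inverse
        (lieBracket (E := E) ℝ V' W' (extChartAt I x x)) :=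
    congrArg (fun v : E ↦ (mfderiv I 𝓘(ℝ, E) (extChartAt I x) x).inverse v)
      (h1 _ _ (key V V' hV) (key W W' hW))
  rw [h3]
  exact map_eq_zero_iff _ hinv.injective

theorem timeCombination_extChartAt_symm [IsManifold I 1 N] [I.Boundaryless] (t : ℝ) (x : N)
    {p : ℝ × E} (hp : p.2 ∈ (extChartAt I x).target) {Z : ι → E → E}
    (hZ : ∀ l, X l ((extChartAt I x).symm p.2) =
      mfderivWithin 𝓘(ℝ, E) I (extChartAt I x).symm (Set.range I) p.2 (Z l p.2)) :
    timeCombination I g b X ((extChartAt (𝓘(ℝ, ℝ).prod I) (t, x)).symm p) =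
      mfderivWithin 𝓘(ℝ, ℝ × E) (𝓘(ℝ, ℝ).prod I) (extChartAt (𝓘(ℝ, ℝ).prod I) (t, x)).symm
        (Set.range (𝓘(ℝ, ℝ).prod I)) p ((g p.1, ∑ l, b p.1 l • Z l p.2) : ℝ × E) := by
  have h1 : MDifferentiableAt 𝓘(ℝ, E) I (extChartAt I x).symm p.2 := by
    have := mdifferentiableWithinAt_extChartAt_symm hp
    rwa [I.range_eq_univ, mdifferentiableWithinAt_univ] at this
  let L : E →L[ℝ] E := mfderiv 𝓘(ℝ, E) I (extChartAt I x).symm p.2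
  have h2 : HasMFDerivAt (𝓘(ℝ, ℝ).prod 𝓘(ℝ, E)) (𝓘(ℝ, ℝ).prod I)
      (Prod.map id (extChartAt I x).symm) p ((ContinuousLinearMap.id ℝ ℝ).prodMap L) := by
    have := HasMFDerivAt.prodMap (p := p) (hasMFDerivAt_id (I := 𝓘(ℝ, ℝ)) p.1) h1.hasMFDerivAt
    rwa [mfderiv_id] at this
  have h3 : HasMFDerivAt 𝓘(ℝ, ℝ × E) (𝓘(ℝ, ℝ).prod I)
      (extChartAt (𝓘(ℝ, ℝ).prod I) (t, x)).symm p ((ContinuousLinearMap.id ℝ ℝ).prodMap L) := h2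
  rw [ModelWithCorners.range_eq_univ, mfderivWithin_univ, h3.mfderiv]
  rw [ModelWithCorners.range_eq_univ, mfderivWithin_univ] at hZ
  refine Prod.ext rfl ?_
  change ∑ l, b p.1 l • X l ((extChartAt I x).symm p.2) = L (∑ l, b p.1 l • Z l p.2)
  rw [map_sum]
  exact Finset.sum_congr rfl fun l _ ↦ (congrArg _ (hZ l)).trans (L.map_smul _ _).symm

theorem mlieBracket_timeCombination_eq_zero [CompleteSpace E] [I.Boundaryless] [IsManifold I ∞ N]
    {h : ℝ → ℝ} {c : ℝ → ι → ℝ} {t : ℝ} {x : N} {g' h' : ℝ} {b' c' : ι → ℝ}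
    (hX : ∀ l, ContMDiff I I.tangent ∞ (fun x ↦ (⟨x, X l x⟩ : TangentBundle I N)))
    (hcomm : ∀ l m, VectorField.mlieBracket I (X l) (X m) x = 0) (hg : HasDerivAt g g' t)
    (hh : HasDerivAt h h' t) (hb : ∀ l, HasDerivAt (fun s ↦ b s l) (b' l) t)
    (hc : ∀ l, HasDerivAt (fun s ↦ c s l) (c' l) t) (hgh : g t * h' = h t * g')
    (hbc : ∀ l, g t * c' l = h t * b' l) :
    VectorField.mlieBracket (𝓘(ℝ, ℝ).prod I) (timeCombination I g b X)
      (timeCombination I h c X) (t, x) = 0 := by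
  have : IsManifold I 1 N := .of_le (n := ∞) (by simp)
  have : IsManifold I 2 N := .of_le (n := ∞) (by norm_cast)
  let Z (l : ι) : E → E := VectorField.mpullbackWithin 𝓘(ℝ, E) I (extChartAt I x).symm (X l)
    (Set.range I)
  have hset : (extChartAt I x).symm ⁻¹' Set.univ ∩ Set.range I = Set.univ := by
    rw [Set.preimage_univ, Set.univ_inter, I.range_eq_univ]
  have hZ (l : ι) : DifferentiableAt ℝ (Z l) (extChartAt I x x) := by
    have := (((hX l x).mdifferentiableAt (by simp)).mdifferentiableWithinAt
      (s := Set.univ)).differentiableWithinAt_mpullbackWithin_vectorField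
    rw [hset] at this
    exact differentiableWithinAt_univ.1 this
  have hZX (l : ι) (y : E) (hy : y ∈ (extChartAt I x).target) :
      X l ((extChartAt I x).symm y) =
        mfderivWithin 𝓘(ℝ, E) I (extChartAt I x).symm (Set.range I) y (Z l y) :=
    ((isInvertible_mfderivWithin_extChartAt_symm hy).self_apply_inverse _).symm
  have hZX' (l : ι) := Filter.eventually_of_mem (extChartAt_target_mem_nhds (I := I) x) (hZX l)
  have hZcomm (l m : ι) : VectorField.lieBracket ℝ (Z l) (Z m) (extChartAt I x x) = 0 :=
    (mlieBracket_eq_zero_iff_lieBracket (hZX' l) (hZX' m)).1 (hcomm l m)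
  have hmem : ∀ᶠ p in 𝓝 (extChartAt (𝓘(ℝ, ℝ).prod I) (t, x) (t, x)),
      p.2 ∈ (extChartAt I x).target :=
    continuousAt_snd (extChartAt_target_mem_nhds (I := I) x)
  refine (mlieBracket_eq_zero_iff_lieBracket
    (hmem.mono fun p hp ↦ timeCombination_extChartAt_symm t x hp fun l ↦ hZX l _ hp)
    (hmem.mono fun p hp ↦ timeCombination_extChartAt_symm t x hp fun l ↦ hZX l _ hp)).2 ?_
  exact lieBracket_prod_combination_eq_zero hZ hZcomm hg hh hb hc hgh hbc

end ProductField

/-! ### Descent of vector fields along a surjective local diffeomorphism -/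

section Descent

variable {E : Type*} [NormedAddCommGroup E] [NormedSpace ℝ E] [CompleteSpace E]
  {H : Type*} [TopologicalSpace H] {I : ModelWithCorners ℝ E H}
  {M : Type*} [TopologicalSpace M] [ChartedSpace H M] [IsManifold I ∞ M]
  {E' : Type*} [NormedAddCommGroup E'] [NormedSpace ℝ E']
  {H' : Type*} [TopologicalSpace H'] {I' : ModelWithCorners ℝ E' H'}
  {M' : Type*} [TopologicalSpace M'] [ChartedSpace H' M'] [IsManifold I' ∞ M']

/-- Commuting independent vector fields that agree on the fibres of a surjective local
diffeomorphism descend to commuting independent vector fields on its target. -/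
theorem IsCommutingIndependentFamily.exists_of_isLocalDiffeomorph {π : M → M'}
    (hπ : IsLocalDiffeomorph I I' ∞ π) (hsurj : Function.Surjective π) {k : ℕ}
    {Y : Fin k → (p : M) → TangentSpace I p} (hY : IsCommutingIndependentFamily I Y)
    (hinv : ∀ i p q, π p = π q →
      tangentMap I I' π (⟨p, Y i p⟩ : TangentBundle I M) = tangentMap I I' π ⟨q, Y i q⟩) :
    ∃ V : Fin k → (q : M') → TangentSpace I' q, IsCommutingIndependentFamily I' V := by
  have : IsManifold I 1 M := .of_le (n := ∞) (by simp)
  have : IsManifold I' 1 M' := .of_le (n := ∞) (by simp)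
  have : IsManifold I (minSmoothness ℝ 2) M := .of_le (n := ∞) (by simp; norm_cast)
  have : IsManifold I' (minSmoothness ℝ 2) M' := .of_le (n := ∞) (by simp; norm_cast)
  have htop : (∞ : WithTop ℕ∞) ≠ 0 := by simp
  have hsm : ContMDiff I I' ∞ π := hπ.contMDiff
  have hinvert (p : M) : (mfderiv I I' π p).IsInvertible :=
    ⟨hπ.mfderivToContinuousLinearEquiv htop p, rfl⟩
  let V (i : Fin k) (q : M') : TangentSpace I' q :=
    (mfderiv I I' π (Function.surjInv hsurj q) (Y i (Function.surjInv hsurj q)) : E')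
  have hV' (i : Fin k) (q : M') : (⟨q, V i q⟩ : TangentBundle I' M') =
      tangentMap I I' π ⟨Function.surjInv hsurj q, Y i (Function.surjInv hsurj q)⟩ :=
    Bundle.TotalSpace.ext (Function.surjInv_eq hsurj q).symm HEq.rfl
  have hV (i : Fin k) (p : M) : (⟨π p, V i (π p)⟩ : TangentBundle I' M') =
      tangentMap I I' π ⟨p, Y i p⟩ :=
    (hV' i (π p)).trans (hinv i _ _ (Function.surjInv_eq hsurj _))
  have hVp (i : Fin k) (p : M) : V i (π p) = mfderiv I I' π p (Y i p) :=
    eq_of_heq (Bundle.TotalSpace.mk.inj (hV i p)).2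
  have hsmooth (i : Fin k) :
      ContMDiff I' I'.tangent ∞ (fun q ↦ (⟨q, V i q⟩ : TangentBundle I' M')) := by
    intro q
    obtain ⟨p, rfl⟩ := hsurj q
    have h1 : ContMDiffAt I' I'.tangent ∞ (fun q ↦ tangentMap I I' π
        (⟨(hπ p).localInverse q, Y i ((hπ p).localInverse q)⟩ : TangentBundle I M)) (π p) :=
      ContMDiffAt.comp (π p)
        (((hsm.contMDiff_tangentMap (m := ∞) (by simp)).comp (hY.smooth i)).contMDiffAt)
        (hπ p).localInverse_contMDiffAt
    refine h1.congr_of_eventuallyEq ?_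
    filter_upwards [(hπ p).localInverse_eventuallyEq_right] with q hq
    have h2 := hV i ((hπ p).localInverse q)
    have h3 : π ((hπ p).localInverse q) = q := hq
    rwa [h3] at h2
  refine ⟨V, hsmooth, fun i j q ↦ ?_, fun q ↦ ?_⟩
  · obtain ⟨p, rfl⟩ := hsurj q
    have hpull (i : Fin k) : VectorField.mpullback I I' π (V i) = Y i := by
      funext p
      rw [VectorField.mpullback_apply, hVp]
      exact (hinvert p).inverse_apply_self _
    have h1 := VectorField.mpullback_mlieBracket (n := ∞)
      ((hsmooth i (π p)).mdifferentiableAt htop) ((hsmooth j (π p)).mdifferentiableAt htop)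
      (hsm p) (by simp; norm_cast)
    rw [hpull, hpull, hY.commute, VectorField.mpullback_apply] at h1
    exact (map_eq_zero_iff _ (hinvert p).inverse.injective).1 h1
  · obtain ⟨p, rfl⟩ := hsurj q
    simp only [hVp]
    exact (hY.linearIndependent p).map' (mfderiv I I' π p).toLinearMap
      (LinearMap.ker_eq_bot.2 (hinvert p).injective)

end Descent

namespace MappingTorus

variable {E : Type*} [NormedAddCommGroup E] [NormedSpace ℝ E]
  {H : Type*} [TopologicalSpace H] {I : ModelWithCorners ℝ E H}
  {N : Type*} [TopologicalSpace N] [ChartedSpace H N]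

/-- The diffeomorphism `(t, x) ↦ (t + k, f ^ k x)` of `ℝ × N`. -/
def translate (f : N ≃ₘ⟮I, I⟯ N) (k : ℤ) :
    (ℝ × N) ≃ₘ⟮𝓘(ℝ, ℝ).prod I, 𝓘(ℝ, ℝ).prod I⟯ (ℝ × N) where
  toFun p := (p.1 + (k : ℝ), (f.toEquiv ^ k) p.2)
  invFun p := (p.1 + ((-k : ℤ) : ℝ), (f.toEquiv ^ (-k)) p.2)
  left_inv p := by
    refine Prod.ext (by push_cast; ring) ?_
    change (f.toEquiv ^ (-k)) ((f.toEquiv ^ k) p.2) = p.2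
    rw [← Equiv.Perm.mul_apply, ← zpow_add, neg_add_cancel, zpow_zero, Equiv.Perm.one_apply]
  right_inv p := by
    refine Prod.ext (by push_cast; ring) ?_
    change (f.toEquiv ^ k) ((f.toEquiv ^ (-k)) p.2) = p.2
    rw [← Equiv.Perm.mul_apply, ← zpow_add, add_neg_cancel, zpow_zero, Equiv.Perm.one_apply]
  contMDiff_toFun := contMDiff_translate f k
  contMDiff_invFun := contMDiff_translate f (-k)

theorem mk_translate (f : N ≃ₘ⟮I, I⟯ N) (k : ℤ) (p : ℝ × N) : mk f (translate f k p) = mk f p :=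
  (mk_eq_mk_iff f _ _).2 ⟨k, rfl⟩

variable [IsManifold I ∞ N]

theorem isLocalDiffeomorph_mk (f : N ≃ₘ⟮I, I⟯ N) :
    IsLocalDiffeomorph (𝓘(ℝ, ℝ).prod I) (𝓘(ℝ, ℝ).prod I) ∞ (mk f) := by
  intro p
  set J : ModelWithCorners ℝ (ℝ × E) (ModelProd ℝ H) := 𝓘(ℝ, ℝ).prod I
  let a : ℝ × N := (mk_surjective f).hasRightInverse.choose (mk f p)
  have ha : mk f a = mk f p := (mk_surjective f).hasRightInverse.choose_spec _
  let e : OpenPartialHomeomorph (MappingTorus f) (ModelProd ℝ H) := chartAt _ (mk f p)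
  let u := (isLocalHomeomorph_mk f).localInverseAt a
  let c : OpenPartialHomeomorph (ℝ × N) (ModelProd ℝ H) := chartAt _ a
  have he : e = u.trans c := rfl
  have hu : u.symm = mk f := (isLocalHomeomorph_mk f).localInverseAt_symm a
  have hmk : IsLocalDiffeomorphAt J J ∞ (mk f) a := by
    let Φ := c.trans e.symm
    refine ⟨⟨Φ.toPartialEquiv, Φ.open_source, Φ.open_target, ?_, ?_⟩, ?_, ?_⟩
    · exact (contMDiffOn_chart_symm (I := J) (n := ∞) (x := mk f p)).comp
        ((contMDiffOn_chart (I := J) (n := ∞) (x := a)).mono fun _ h ↦ h.1) fun _ h ↦ h.2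
    · exact (contMDiffOn_chart_symm (I := J) (n := ∞) (x := a)).comp
        ((contMDiffOn_chart (I := J) (n := ∞) (x := mk f p)).mono fun _ h ↦ h.1) fun _ h ↦ h.2
    · refine ⟨mem_chart_source _ a, ?_⟩
      change c a ∈ e.target
      rw [he, OpenPartialHomeomorph.trans_target]
      refine ⟨c.map_source (mem_chart_source _ a), ?_⟩
      rw [Set.mem_preimage, c.left_inv (mem_chart_source _ a)]
      exact (isLocalHomeomorph_mk f).self_mem_localInverseAt_target
    · intro x hx
      change mk f x = e.symm (c x)
      rw [he, OpenPartialHomeomorph.coe_trans_symm, Function.comp_apply, c.left_inv hx.1, hu]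
  obtain ⟨k, hk⟩ := (mk_eq_mk_iff f _ _).1 ha
  have hk' : translate f k p = a := hk
  rw [← hk'] at hmk
  have := ((translate f k).isLocalDiffeomorph p).comp _ _ hmk
  have hcomp : mk f ∘ translate f k = mk f := funext (mk_translate f k)
  rwa [hcomp] at this

end MappingTorus

/-! ### The rank of a mapping torus -/

section Rank

variable {E : Type*} [NormedAddCommGroup E] [NormedSpace ℝ E]
  {H : Type*} [TopologicalSpace H] {I : ModelWithCorners ℝ E H}
  {N : Type*} [TopologicalSpace N] [ChartedSpace H N] {k : ℕ}

open Matrix in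
theorem IsCommutingIndependentFamily.timeCombination [CompleteSpace E] [I.Boundaryless]
    [IsManifold I ∞ N]
    {X : Fin k → (x : N) → TangentSpace I x} (hX : IsCommutingIndependentFamily I X)
    {B : ℝ → Matrix (Fin k) (Fin k) ℝ} {g : ℝ → Fin k → ℝ}
    (hB : ∀ i l, ContDiff ℝ ∞ (fun t ↦ B t i l)) (hg : ∀ i, ContDiff ℝ ∞ (fun t ↦ g t i))
    (hframe : ∀ t, IsCommutingFrameAt B g t) :
    IsCommutingIndependentFamily (𝓘(ℝ, ℝ).prod I)
      (fun i ↦ _root_.timeCombination I (fun t ↦ g t i) (fun t ↦ B t i) X) where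
  smooth i := contMDiff_timeCombination (hg i) (hB i) hX.smooth
  commute i j p := by
    obtain ⟨B', hB', hgB⟩ := (hframe p.1).exists_hasDerivAt
    obtain ⟨g', hg', hgg⟩ := (hframe p.1).exists_hasDerivAt'
    exact mlieBracket_timeCombination_eq_zero hX.smooth (fun l m ↦ hX.commute l m p.2)
      (hg' i) (hg' j) (hB' i) (hB' j) (hgg i j) (hgB i j)
  linearIndependent p := by
    refine Fintype.linearIndependent_iff.2 fun c hc ↦ ?_
    have hc' : ∑ i, c i • ((g p.1 i, ∑ l, B p.1 i l • X l p.2) : ℝ × TangentSpace I p.2) = 0 := hc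
    have h1 := congrArg Prod.fst hc'
    have h2 := congrArg Prod.snd hc'
    simp only [Prod.fst_sum, Prod.snd_sum, Prod.smul_mk, smul_eq_mul, Prod.fst_zero,
      Prod.snd_zero] at h1 h2
    simp only [Finset.smul_sum, smul_smul] at h2
    rw [Finset.sum_comm] at h2
    simp only [← Finset.sum_smul] at h2
    have h3 := Fintype.linearIndependent_iff.1 (hX.linearIndependent p.2) _ h2
    exact congrFun ((hframe p.1).independent c (funext h3) h1)

namespace MappingTorus

/-- A quasi-periodic combination of fields transformed by `f` is invariant under
`(t, x) ↦ (t + 1, f x)`. -/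
theorem tangentMap_translate_one_timeCombination (f : N ≃ₘ⟮I, I⟯ N)
    {X : Fin k → (x : N) → TangentSpace I x} {A : Matrix (Fin k) (Fin k) ℝ}
    (hA : ∀ i x, mfderiv I I f x (X i x) = ∑ j, A i j • X j (f x))
    {g : ℝ → ℝ} {b : ℝ → Fin k → ℝ} (hg : ∀ t, g (t + 1) = g t)
    (hb : ∀ t, b (t + 1) = Matrix.vecMul (b t) A) (p : ℝ × N) :
    tangentMap (𝓘(ℝ, ℝ).prod I) (𝓘(ℝ, ℝ).prod I) (translate f 1)
        ⟨p, timeCombination I g b X p⟩ =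
      ⟨translate f 1 p, timeCombination I g b X (translate f 1 p)⟩ := by
  have htr : (translate f 1 : ℝ × N → ℝ × N) = Prod.map (fun t ↦ t + 1) f := by
    funext q
    refine Prod.ext ?_ ?_
    · change q.1 + ((1 : ℤ) : ℝ) = q.1 + 1
      rw [Int.cast_one]
    · change (f.toEquiv ^ (1 : ℤ)) q.2 = f q.2
      rw [zpow_one]
      rfl
  let L : E →L[ℝ] E := mfderiv I I f p.2
  have hone : HasMFDerivAt 𝓘(ℝ, ℝ) 𝓘(ℝ, ℝ) (fun t : ℝ ↦ t + 1) p.1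
      (ContinuousLinearMap.id ℝ ℝ) := ((hasFDerivAt_id p.1).add_const 1).hasMFDerivAt
  have hder : HasMFDerivAt (𝓘(ℝ, ℝ).prod I) (𝓘(ℝ, ℝ).prod I) (Prod.map (fun t : ℝ ↦ t + 1) f) p
      ((ContinuousLinearMap.id ℝ ℝ).prodMap L) := by
    have := HasMFDerivAt.prodMap (p := p) hone
      (f.contMDiff.mdifferentiable (by simp) p.2).hasMFDerivAt
    rwa [hone.mfderiv] at this
  rw [htr]
  refine Bundle.TotalSpace.ext rfl (heq_of_eq ?_)
  rw [tangentMap, hder.mfderiv]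
  refine Prod.ext (hg p.1).symm ?_
  let u : Fin k → E := fun l ↦ X l p.2
  let v : Fin k → E := fun j ↦ X j (f p.2)
  have hL (l : Fin k) : L (u l) = ∑ j, A l j • v j := hA l p.2
  change L (∑ l, b p.1 l • u l) = ∑ m, b (p.1 + 1) m • v m
  rw [hb, map_sum]
  simp only [map_smul, hL, Finset.smul_sum, smul_smul, Matrix.vecMul, dotProduct,
    Finset.sum_smul]
  rw [Finset.sum_comm]

theorem tangentMap_mk_eq_of_mk_eq [IsManifold I ∞ N] (f : N ≃ₘ⟮I, I⟯ N)
    {Y : (p : ℝ × N) → TangentSpace (𝓘(ℝ, ℝ).prod I) p}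
    (hY : ∀ p, tangentMap (𝓘(ℝ, ℝ).prod I) (𝓘(ℝ, ℝ).prod I) (translate f 1) ⟨p, Y p⟩ =
      ⟨translate f 1 p, Y (translate f 1 p)⟩) {p q : ℝ × N} (hpq : mk f p = mk f q) :
    tangentMap (𝓘(ℝ, ℝ).prod I) (𝓘(ℝ, ℝ).prod I) (mk f) ⟨p, Y p⟩ =
      tangentMap (𝓘(ℝ, ℝ).prod I) (𝓘(ℝ, ℝ).prod I) (mk f) ⟨q, Y q⟩ := by
  have hstep (p : ℝ × N) :
      tangentMap (𝓘(ℝ, ℝ).prod I) (𝓘(ℝ, ℝ).prod I) (mk f)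
        ⟨translate f 1 p, Y (translate f 1 p)⟩ =
      tangentMap (𝓘(ℝ, ℝ).prod I) (𝓘(ℝ, ℝ).prod I) (mk f) ⟨p, Y p⟩ := by
    have hcomp : mk f ∘ translate f 1 = mk f := funext (mk_translate f 1)
    rw [← hY]
    conv_rhs => rw [← hcomp]
    exact (tangentMap_comp_at _ ((isLocalDiffeomorph_mk f).mdifferentiable (by simp) _)
      ((translate f 1).contMDiff.mdifferentiable (by simp) _)).symm
  have hsucc (m : ℤ) (p : ℝ × N) : translate f (m + 1) p = translate f 1 (translate f m p) := by
    refine Prod.ext ?_ ?_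
    · change p.1 + ((m + 1 : ℤ) : ℝ) = p.1 + (m : ℝ) + ((1 : ℤ) : ℝ)
      push_cast
      ring
    · change (f.toEquiv ^ (m + 1)) p.2 = (f.toEquiv ^ (1 : ℤ)) ((f.toEquiv ^ m) p.2)
      rw [add_comm, zpow_add, Equiv.Perm.mul_apply]
  obtain ⟨m, hm⟩ := (mk_eq_mk_iff f _ _).1 hpq
  have hm' : translate f m q = p := hm
  rw [← hm']
  clear hm hm' hpq
  induction m using Int.induction_on with
  | zero =>
    have : translate f 0 q = q := Prod.ext (by
      change q.1 + ((0 : ℤ) : ℝ) = q.1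
      simp) rfl
    rw [this]
  | succ m ih => rw [hsucc, hstep, ih]
  | pred m ih =>
    have := hsucc (-m - 1) q
    rw [sub_add_cancel] at this
    rw [← hstep, ← this, ih]

end MappingTorus

end Rank

end

/-- Let `f : N → N` be a diffeomorphism of a smooth manifold and `X₁, …, X_k` commuting smooth
vector fields on `N`, linearly independent everywhere, with `f_* X_i = ∑ⱼ a i j X_j` for a constant
invertible matrix `a`; the pushforward identity is written at the point `f x`. Then the rank of the
mapping torus of `f` is at least `k`. -/
theorem lemma1 {E : Type*} [NormedAddCommGroup E] [NormedSpace ℝ E] [FiniteDimensional ℝ E]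
    {H : Type*} [TopologicalSpace H] (I : ModelWithCorners ℝ E H) [I.Boundaryless]
    {N : Type*} [TopologicalSpace N] [ChartedSpace H N] [IsManifold I ∞ N]
    (f : N ≃ₘ⟮I, I⟯ N) (k : ℕ) (X : Fin k → (x : N) → TangentSpace I x)
    (hX : IsCommutingIndependentFamily I X)
    (a : Matrix.GeneralLinearGroup (Fin k) ℝ)
    (ha : ∀ i x, mfderiv I I f x (X i x) = ∑ j, (a : Matrix (Fin k) (Fin k) ℝ) i j • X j (f x)) :
    (k : ℕ∞) ≤ manifoldRank (𝓘(ℝ, ℝ).prod I) (MappingTorus f) := by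
  obtain ⟨B, g, hB, hg, hframe, hBA, hgA⟩ := exists_quasiperiodic_commutingFrame a
  have : CompleteSpace E := FiniteDimensional.complete ℝ E
  have hY := hX.timeCombination hB hg hframe
  refine le_iSup₂_of_le k (hY.exists_of_isLocalDiffeomorph (MappingTorus.isLocalDiffeomorph_mk f)
    (MappingTorus.mk_surjective f) fun i p q hpq ↦ ?_) le_rfl
  refine MappingTorus.tangentMap_mk_eq_of_mk_eq f (fun p ↦ ?_) hpq
  refine MappingTorus.tangentMap_translate_one_timeCombination f ha (fun t ↦ ?_) (fun t ↦ ?_) p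
  · rw [hgA]
  · rw [hBA]
    rfl
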